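/- A $\mathbb Z$-group is a linearly ordered abelian group $(G,+,\le)$ that is a model of $\mathrm{Th}(\mathbb Z,+,\le)$, the complete first-order theory of the ordered group of integers. Such a $G$ has a least positive element, denoted $1$. For each integer $n>0$ there is a unique group homomorphism $\mathrm{res}_n\colon G\to\mathbb Z/n\mathbb Z$ with $\mathrm{res}_n(1)=1$; together these maps give the residue map $\mathrm{res}\colon G\to\hat{\mathbb Z}=\varprojlim_{n}\mathbb Z/n\mathbb Z$, $x\mapsto(\mathrm{res}_n(x))_{n>0}$, where the limit is over the positive integers ordered by divisibility. A first-order structure $M$ is called Leibnizian if for any $a\ne b$ in $M$ there is a first-order formula $\varphi(x)$ without parameters, in the language of $M$, such that $M\models\varphi(a)$ and $M\not\models\varphi(b)$; in other words, distinct elements of $M$ have distinct parameter-free $1$-types. Theorem. For any $\mathbb Z$-group $(G,+,\le)$, with least positive element $1$, the following are equivalent. (1) The structure $(G,+,\le)$ is Leibnizian. (2) The structure $(G,+,1)$, obtained by dropping the order and naming the element $1$, is Leibnizian. (3) The residue map $\mathrm{res}\colon G\to\hat{\mathbb Z}$ is injective. -/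

import Mathlib

open scoped FirstOrder

namespace ZGroups

universe u v w

/-- A structure `M` is Leibnizian if any two distinct elements are told apart by a
parameter-free formula in one free variable. -/
def Leibnizian (L : FirstOrder.Language.{u, v}) (M : Type w) [L.Structure M] : Prop :=
  ∀ a b : M, a ≠ b →
    ∃ φ : L.Formula (Fin 1), φ.Realize (fun _ => a) ∧ ¬ φ.Realize (fun _ => b)

/-! ### The languages `(+, ≤)` and `(+, 1)` -/

/-- The only function symbol of the language `(+, ≤)`. -/
inductive OrdFunc : ℕ → Type
  | add : OrdFunc 2

/-- The only relation symbol of the language `(+, ≤)`. -/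
inductive OrdRel : ℕ → Type
  | le : OrdRel 2

/-- The language `(+, ≤)` of ordered groups. -/
def ordLang : FirstOrder.Language.{0, 0} where
  Functions := OrdFunc
  Relations := OrdRel

/-- The structure `(M, +, ≤)`. -/
instance ordStructure (M : Type w) [Add M] [LE M] : ordLang.Structure M where
  funMap
    | .add, v => v 0 + v 1
  RelMap
    | .le, v => v 0 ≤ v 1

/-- The function symbols of the language `(+, 1)`. -/
inductive PtFunc : ℕ → Type
  | one : PtFunc 0
  | add : PtFunc 2

/-- The language `(+, 1)` of groups with a distinguished element. -/
def ptLang : FirstOrder.Language.{0, 0} where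
  Functions := PtFunc
  Relations := fun _ => Empty

/-- The structure `(M, +, e)`, the constant symbol `1` being interpreted by `e`. -/
@[reducible]
def ptStructure {M : Type w} [Add M] (e : M) : ptLang.Structure M where
  funMap
    | .one, _ => e
    | .add, v => v 0 + v 1
  RelMap := fun r _ => r.elim

/-! ### `ℤ`-groups -/

/-- A (linearly) ordered abelian group `G` is a `ℤ`-group if `(G, +, ≤)` is a model of the
complete first-order theory of `(ℤ, +, ≤)`. -/
def IsPresburgerGroup (G : Type w) [AddCommGroup G] [LinearOrder G] [IsOrderedAddMonoid G] : Prop :=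
  G ⊨ ordLang.completeTheory ℤ

/-! ### The profinite integers -/

/-- The profinite completion `ℤ̂ = lim ℤ/nℤ` of `ℤ`, the inverse limit being taken over the positive
integers ordered by divisibility. -/
def ZHat : Subring (∀ n : ℕ+, ZMod n) where
  carrier := {f | ∀ (m n : ℕ+) (h : (m : ℕ) ∣ n), ZMod.castHom h (ZMod m) (f n) = f m}
  mul_mem' hf hg m n h := by simp only [Pi.mul_apply, map_mul, hf m n h, hg m n h]
  one_mem' m n h := by simp only [Pi.one_apply, map_one]
  add_mem' hf hg m n h := by simp only [Pi.add_apply, map_add, hf m n h, hg m n h]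
  zero_mem' m n h := by simp only [Pi.zero_apply, map_zero]
  neg_mem' hf m n h := by simp only [Pi.neg_apply, map_neg, hf m n h]

/-! ### First-order facts needed for the least positive element and for the residue maps -/

/-- The term `s + t`. -/
def addT {α : Type} (s t : ordLang.Term α) : ordLang.Term α :=
  FirstOrder.Language.Functions.apply₂ (L := ordLang) OrdFunc.add s t

/-- The term `s + t + ⋯ + t`, with `k` summands `t`. -/
def addMulT {α : Type} (s t : ordLang.Term α) : ℕ → ordLang.Term α
  | 0 => s
  | k + 1 => addT (addMulT s t k) t

/-- The formula `s ≤ t`. -/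
def leF {n : ℕ} (s t : ordLang.Term (Empty ⊕ Fin n)) : ordLang.BoundedFormula Empty n :=
  FirstOrder.Language.Relations.boundedFormula₂ (L := ordLang) OrdRel.le s t

/-- The sentence saying that there are a zero element and a least positive element `1` such that
each element `x` has the form `n y + k 1` with `k < n`. -/
noncomputable def divSentence (n : ℕ) : ordLang.Sentence :=
  FirstOrder.Language.BoundedFormula.ex <| FirstOrder.Language.BoundedFormula.ex <|
    ((addT (&0) (&0)).bdEqual (&0 : ordLang.Term (Empty ⊕ Fin 2)) ⊓ ∼(leF (&1) (&0)) ⊓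
      FirstOrder.Language.BoundedFormula.all (∼(leF (&2) (&0)) ⟹ leF (&1) (&2))) ⊓
    FirstOrder.Language.BoundedFormula.all (FirstOrder.Language.BoundedFormula.ex
      (FirstOrder.Language.BoundedFormula.iSup fun k : Fin n =>
        (&2 : ordLang.Term (Empty ⊕ Fin 4)).bdEqual
          (addMulT (addMulT (&0) (&3) n) (&1) k)))

section Realize

variable {M : Type w} [AddCommGroup M] [LinearOrder M]

theorem realize_addT {α : Type} (s t : ordLang.Term α) (v : α → M) :
    (addT s t).realize v = s.realize v + t.realize v := rfl

theorem realize_addMulT {α : Type} (s t : ordLang.Term α) (v : α → M) (k : ℕ) :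
    (addMulT s t k).realize v = s.realize v + k • t.realize v := by
  induction k with
  | zero => simp [addMulT]
  | succ k ih => rw [addMulT, realize_addT, ih, succ_nsmul, add_assoc]

theorem realize_leF {n : ℕ} (s t : ordLang.Term (Empty ⊕ Fin n)) (v : Empty → M) (xs : Fin n → M) :
    (leF s t).Realize v xs ↔
      s.realize (Sum.elim v xs) ≤ t.realize (Sum.elim v xs) := Iff.rfl

theorem realize_divSentence (n : ℕ) :
    M ⊨ divSentence n ↔
      ∃ e : M, IsLeast {x : M | 0 < x} e ∧ ∀ x : M, ∃ y : M, ∃ k : Fin n,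
        x = n • y + (k : ℕ) • e := by
  simp [divSentence, FirstOrder.Language.Sentence.Realize, FirstOrder.Language.Formula.Realize,
    realize_addT, realize_addMulT, realize_leF, Fin.snoc, IsLeast, mem_lowerBounds]

end Realize

theorem int_divSentence (n : ℕ) (hn : 0 < n) : ℤ ⊨ divSentence n := by
  rw [realize_divSentence]
  refine ⟨1, ⟨by simp, fun x hx => ?_⟩, fun x => ⟨x / n, ⟨(x % n).toNat, ?_⟩, ?_⟩⟩
  · have : (0 : ℤ) < x := hx
    omega
  · have h1 := Int.emod_lt_of_pos x (b := n) (by omega)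
    omega
  · have h1 := Int.emod_nonneg x (b := n) (by omega)
    have h2 := Int.mul_ediv_add_emod x n
    simp only [nsmul_eq_mul, Int.toNat_of_nonneg h1, mul_one]
    omega

namespace IsPresburgerGroup

variable {G : Type w} [AddCommGroup G] [LinearOrder G] [IsOrderedAddMonoid G]

theorem exists_div (hG : IsPresburgerGroup G) (n : ℕ) (hn : 0 < n) :
    ∃ e : G, IsLeast {x : G | 0 < x} e ∧ ∀ x : G, ∃ y : G, ∃ k : Fin n,
      x = n • y + (k : ℕ) • e :=
  (realize_divSentence n).1 (hG.realize_of_mem _ (int_divSentence n hn))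

theorem exists_isLeast (hG : IsPresburgerGroup G) : ∃ e : G, IsLeast {x : G | 0 < x} e :=
  let ⟨e, he, _⟩ := hG.exists_div 1 one_pos
  ⟨e, he⟩

/-- The least positive element of a `ℤ`-group. -/
noncomputable def one (hG : IsPresburgerGroup G) : G := hG.exists_isLeast.choose

theorem isLeast_one (hG : IsPresburgerGroup G) : IsLeast {x : G | 0 < x} hG.one :=
  hG.exists_isLeast.choose_spec

theorem exists_eq (hG : IsPresburgerGroup G) (n : ℕ+) (x : G) :
    ∃ (k : ℤ) (y : G), x = (n : ℤ) • y + k • hG.one := by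
  obtain ⟨e, he, h⟩ := hG.exists_div n n.pos
  obtain ⟨y, k, hk⟩ := h x
  refine ⟨(k : ℕ), y, ?_⟩
  rw [hG.isLeast_one.unique he, natCast_zsmul, natCast_zsmul]
  exact hk

theorem dvd_of_eq (hG : IsPresburgerGroup G) (n : ℕ+) (k : ℤ) (y : G)
    (h : (n : ℤ) • y = k • hG.one) : (n : ℤ) ∣ k := by
  have h1 : (0 : G) < hG.one := hG.isLeast_one.1
  have hn : (0 : ℤ) < n := by exact_mod_cast n.pos
  have key : (n : ℤ) • (y - (k / n) • hG.one) = (k % n) • hG.one := by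
    rw [smul_sub, h, smul_smul, ← sub_smul]
    congr 1
    have := Int.mul_ediv_add_emod k n
    omega
  have h0 := Int.emod_nonneg k hn.ne'
  have hlt := Int.emod_lt_of_pos k hn
  rcases h0.eq_or_lt with h0 | h0
  · exact Int.dvd_of_emod_eq_zero h0.symm
  · exfalso
    set z := y - (k / n) • hG.one
    have hz : 0 < z := by
      have : 0 < (n : ℤ) • z := key ▸ zsmul_pos h1 h0
      by_contra hz
      exact absurd (zsmul_nonneg (neg_nonneg.2 (not_lt.1 hz)) hn.le) (by simpa using this)
    have h2 : hG.one ≤ z := hG.isLeast_one.2 hz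
    have h3 : (n : ℤ) • hG.one ≤ (n : ℤ) • z := zsmul_le_zsmul_right hn.le h2
    rw [key] at h3
    exact absurd ((zsmul_le_zsmul_iff_left h1).1 h3) (not_le.2 hlt)

theorem cast_eq_of_eq (hG : IsPresburgerGroup G) (n : ℕ+) {k l : ℤ} {y z : G}
    (h : (n : ℤ) • y + k • hG.one = (n : ℤ) • z + l • hG.one) : (k : ZMod n) = l := by
  have : (n : ℤ) ∣ l - k := hG.dvd_of_eq n (l - k) (y - z) (by
    rw [smul_sub, sub_smul, sub_eq_sub_iff_add_eq_add, h, add_comm])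
  exact (ZMod.intCast_eq_intCast_iff_dvd_sub k l n).2 this

theorem existsUnique_residueMod (hG : IsPresburgerGroup G) (n : ℕ+) :
    ∃! f : G →+ ZMod n, f hG.one = 1 := by
  choose k y hk using hG.exists_eq n
  refine ⟨AddMonoidHom.mk' (fun x => (k x : ZMod n)) fun a b => ?_, ?_, fun f hf => ?_⟩
  · rw [← Int.cast_add]
    refine hG.cast_eq_of_eq n (y := y (a + b)) (z := y a + y b) ?_
    rw [← hk (a + b), smul_add, add_smul, add_add_add_comm, ← hk a, ← hk b]
  · have := hG.cast_eq_of_eq n (k := k hG.one) (l := 1) (y := y hG.one) (z := 0) (by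
      rw [← hk, smul_zero, zero_add, one_smul])
    simpa using this
  · ext x
    conv_lhs => rw [hk x]
    simp [hf]

/-- The residue map `G → ℤ/nℤ`: the unique group homomorphism that sends `1` to `1`. -/
noncomputable def residueMod (hG : IsPresburgerGroup G) (n : ℕ+) : G →+ ZMod n :=
  (hG.existsUnique_residueMod n).choose

theorem residueMod_one (hG : IsPresburgerGroup G) (n : ℕ+) : hG.residueMod n hG.one = 1 :=
  (hG.existsUnique_residueMod n).choose_spec.1

theorem eq_residueMod (hG : IsPresburgerGroup G) (n : ℕ+) (f : G →+ ZMod n) (hf : f hG.one = 1) :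
    f = hG.residueMod n :=
  (hG.existsUnique_residueMod n).choose_spec.2 f hf

theorem residueMod_mem (hG : IsPresburgerGroup G) (x : G) : (fun n => hG.residueMod n x) ∈ ZHat := by
  intro m n h
  have := hG.eq_residueMod m ((ZMod.castHom h (ZMod m)).toAddMonoidHom.comp (hG.residueMod n))
    (by
      change ZMod.castHom h (ZMod m) (hG.residueMod n hG.one) = 1
      rw [residueMod_one, map_one])
  exact DFunLike.congr_fun this x

/-- The residue map `G → ℤ̂`, with the components `residueMod n`. -/
noncomputable def residue (hG : IsPresburgerGroup G) : G →+ ZHat where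
  toFun x := ⟨fun n => hG.residueMod n x, hG.residueMod_mem x⟩
  map_zero' := Subtype.ext (funext fun n => map_zero (hG.residueMod n))
  map_add' x y := Subtype.ext (funext fun n => map_add (hG.residueMod n) x y)

end IsPresburgerGroup

end ZGroups

/-!
Distinct elements with distinct residues are told apart by a formula `∃ y, x = n y + k 1`, in which
the constant `1` can be replaced by its definition from the order. So an injective residue map makes
both structures Leibnizian.

For the converse, two tuples `x`, `y` in `G` are called `(N, m)`-similar (`Similar`) if the linear
forms `∑ cᵢ Xᵢ + d 1` with integer coefficients bounded by `N` take values of the same sign at `x`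
and at `y`, and `xᵢ ≡ yᵢ` modulo `m` for all `i`. Sufficiently similar tuples have the
back-and-forth property (`Similar.exists_extend`): for each `N`, `m` there are `N'`, `m'` such that,
if `x` and `y` are `(N', m')`-similar, then for each `a` there is a `b` with `(x, a)` and `(y, b)`
being `(N, m)`-similar. By induction on formulas, the truth value of each formula is constant on the
classes of `(N, m)`-similarity for some `N` and `m` (`isDetermined_realize`); this is quantifier
elimination for Presburger arithmetic, in semantic form.

If the residue map is not injective, its kernel contains some `a > 0`. Then `a` is divisible by all
positive integers and exceeds all integer multiples of `1`, hence `a` and `2a` are `(N, m)`-similar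
for all `N` and `m` and satisfy the same formulas, both in `(G, +, ≤)` and in `(G, +, 1)`.
-/

namespace ZGroups

open FirstOrder FirstOrder.Language

variable {G : Type*} [AddCommGroup G]

/-! ### Linear forms -/

section LinForm

variable {ι : Type*} [Fintype ι]

/-- The value at `x` of the linear form with coefficients `c` and constant term `d • e`. -/
def linForm (e : G) (c : ι → ℤ) (d : ℤ) (x : ι → G) : G := ∑ i, c i • x i + d • e

theorem linForm_add (e : G) (c c' : ι → ℤ) (d d' : ℤ) (x : ι → G) :
    linForm e (c + c') (d + d') x = linForm e c d x + linForm e c' d' x := by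
  simp only [linForm, Pi.add_apply, add_smul, Finset.sum_add_distrib]
  abel

theorem linForm_smul (e : G) (q : ℤ) (c : ι → ℤ) (d : ℤ) (x : ι → G) :
    linForm e (q • c) (q • d) x = q • linForm e c d x := by
  simp only [linForm, Pi.smul_apply, smul_assoc, smul_add, Finset.smul_sum]

theorem linForm_sub (e : G) (c c' : ι → ℤ) (d d' : ℤ) (x : ι → G) :
    linForm e (c - c') (d - d') x = linForm e c d x - linForm e c' d' x := by
  simp only [linForm, Pi.sub_apply, sub_smul, Finset.sum_sub_distrib]
  abel

theorem linForm_add_const (e : G) (c : ι → ℤ) (d r : ℤ) (x : ι → G) :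
    linForm e c (d + r) x = linForm e c d x + r • e := by
  simp only [linForm, add_smul, add_assoc]

theorem linForm_neg_arg (e : G) (c : ι → ℤ) (d : ℤ) (x : ι → G) :
    linForm e c d (-x) = linForm e (-c) d x := by
  simp [linForm]

theorem linForm_single [DecidableEq ι] (e : G) (i : ι) (x : ι → G) :
    linForm e (Pi.single i 1) 0 x = x i := by
  simp [linForm, Pi.single_apply, ite_smul]

theorem linForm_zero (e : G) (x : ι → G) : linForm e 0 0 x = 0 := by simp [linForm]

theorem linForm_sumElim_snoc {α : Type*} [Fintype α] {n : ℕ} (e : G) (c : α ⊕ Fin (n + 1) → ℤ)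
    (d : ℤ) (v : α → G) (xs : Fin n → G) (a : G) :
    linForm e c d (Sum.elim v (Fin.snoc xs a : Fin (n + 1) → G)) =
      linForm e (Sum.elim (c ∘ Sum.inl) (c ∘ Sum.inr ∘ Fin.castSucc)) d (Sum.elim v xs) +
        c (Sum.inr (Fin.last n)) • a := by
  simp [linForm, Fintype.sum_sum_type, Fin.sum_univ_castSucc]
  abel

theorem exists_linForm_realize_ordLang [LE G] (e : G) (t : ordLang.Term ι) :
    ∃ (c : ι → ℤ) (d : ℤ), ∀ x : ι → G, t.realize x = linForm e c d x := by
  classical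
  induction t with
  | var i => exact ⟨Pi.single i 1, 0, fun x => (linForm_single e i x).symm⟩
  | func f ts ih =>
    choose c d h using ih
    cases f
    refine ⟨c 0 + c 1, d 0 + d 1, fun x => ?_⟩
    rw [linForm_add, ← h, ← h]
    rfl

theorem exists_linForm_realize_ptLang (e : G) (t : ptLang.Term ι) :
    ∃ (c : ι → ℤ) (d : ℤ), ∀ x : ι → G,
      @Term.realize ptLang G (ptStructure e) ι x t = linForm e c d x := by
  classical
  let := ptStructure e
  induction t with
  | var i => exact ⟨Pi.single i 1, 0, fun x => (linForm_single e i x).symm⟩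
  | func f ts ih =>
    choose c d h using ih
    cases f
    · refine ⟨0, 1, fun x => ?_⟩
      simp only [linForm, Pi.zero_apply, zero_smul, Finset.sum_const_zero, zero_add, one_smul]
      rfl
    · refine ⟨c 0 + c 1, d 0 + d 1, fun x => ?_⟩
      rw [linForm_add, ← h, ← h]
      rfl

end LinForm

/-! ### Similar tuples -/

section Similar

variable {ι : Type*} [Fintype ι] [LinearOrder G]

/-- The tuples `x` and `y` are `(N, m)`-similar: linear forms with integer coefficients bounded by
`N` take values of the same sign at `x` and at `y`, and `x` and `y` are congruent modulo `m`. The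
bound also applies to the coefficient of the constant `e`. As a linear form may be negated, it is
enough to speak of nonnegative values. -/
structure Similar (e : G) (N m : ℕ) (x y : ι → G) : Prop where
  nonneg_iff : ∀ (c : ι → ℤ) (d : ℤ), (∀ i, |c i| ≤ N) → |d| ≤ N →
    (0 ≤ linForm e c d x ↔ 0 ≤ linForm e c d y)
  modEq : ∀ i, ∃ z, x i = y i + m • z

namespace Similar

variable {e : G} {N N' m m' : ℕ} {x y : ι → G}

theorem symm (h : Similar e N m x y) : Similar e N m y x where
  nonneg_iff c d hc hd := (h.nonneg_iff c d hc hd).symm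
  modEq i := by
    obtain ⟨z, hz⟩ := h.modEq i
    exact ⟨-z, by rw [hz]; simp⟩

theorem mono (h : Similar e N m x y) (hN : N' ≤ N) (hm : m' ∣ m) : Similar e N' m' x y where
  nonneg_iff c d hc hd := by
    have hN : (N' : ℤ) ≤ N := by exact_mod_cast hN
    exact h.nonneg_iff c d (fun i => (hc i).trans hN) (hd.trans hN)
  modEq i := by
    obtain ⟨z, hz⟩ := h.modEq i
    obtain ⟨k, rfl⟩ := hm
    exact ⟨k • z, by rw [hz, mul_smul]⟩

theorem neg (h : Similar e N m x y) : Similar e N m (-x) (-y) where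
  nonneg_iff c d hc hd := by
    rw [linForm_neg_arg, linForm_neg_arg]
    exact h.nonneg_iff _ d (fun i => by simpa using hc i) hd
  modEq i := by
    obtain ⟨z, hz⟩ := h.modEq i
    exact ⟨-z, by simp [hz, add_comm]⟩

theorem linForm_modEq (h : Similar e N m x y) (c : ι → ℤ) (d : ℤ) :
    ∃ z, linForm e c d x = linForm e c d y + m • z := by
  choose z hz using h.modEq
  refine ⟨∑ i, c i • z i, ?_⟩
  simp only [linForm, hz, smul_add, Finset.sum_add_distrib, Finset.smul_sum]
  simp only [smul_comm m]
  abel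

theorem le_iff [IsOrderedAddMonoid G] (h : Similar e N m x y) {c c' : ι → ℤ} {d d' : ℤ}
    (hc : ∀ i, |c i - c' i| ≤ N) (hd : |d - d'| ≤ N) :
    linForm e c' d' x ≤ linForm e c d x ↔ linForm e c' d' y ≤ linForm e c d y := by
  have := h.nonneg_iff (c - c') (d - d') hc hd
  rwa [linForm_sub, linForm_sub, sub_nonneg, sub_nonneg] at this

end Similar

/-- A property of tuples is determined if, for some `N` and `m > 0`, it is invariant under
`(N, m)`-similarity. -/
def IsDetermined (e : G) (P : (ι → G) → Prop) : Prop :=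
  ∃ N m : ℕ, 0 < m ∧ ∀ x y, Similar e N m x y → P x → P y

namespace IsDetermined

variable {e : G} {P Q : (ι → G) → Prop}

theorem imp (hP : IsDetermined e P) (hQ : IsDetermined e Q) :
    IsDetermined e fun x => P x → Q x := by
  obtain ⟨N₁, m₁, hm₁, h₁⟩ := hP
  obtain ⟨N₂, m₂, hm₂, h₂⟩ := hQ
  refine ⟨max N₁ N₂, m₁ * m₂, Nat.mul_pos hm₁ hm₂, fun x y h hx hy => ?_⟩
  exact h₂ x y (h.mono (le_max_right _ _) (dvd_mul_left _ _))
    (hx (h₁ y x (h.symm.mono (le_max_left _ _) (dvd_mul_right _ _)) hy))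

theorem and (hP : IsDetermined e P) (hQ : IsDetermined e Q) :
    IsDetermined e fun x => P x ∧ Q x := by
  obtain ⟨N₁, m₁, hm₁, h₁⟩ := hP
  obtain ⟨N₂, m₂, hm₂, h₂⟩ := hQ
  refine ⟨max N₁ N₂, m₁ * m₂, Nat.mul_pos hm₁ hm₂, fun x y h hx => ⟨?_, ?_⟩⟩
  · exact h₁ x y (h.mono (le_max_left _ _) (dvd_mul_right _ _)) hx.1
  · exact h₂ x y (h.mono (le_max_right _ _) (dvd_mul_left _ _)) hx.2

end IsDetermined

end Similar

/-! ### The back-and-forth property -/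

section Order

variable [LinearOrder G] [IsOrderedAddMonoid G]

namespace IsPresburgerGroup

theorem exists_divMod (hG : IsPresburgerGroup G) {n : ℕ} (hn : 0 < n) (x : G) :
    ∃ (y : G) (k : ℕ), k < n ∧ x = n • y + k • hG.one := by
  obtain ⟨e, he, h⟩ := hG.exists_div n hn
  obtain ⟨y, k, hk⟩ := h x
  rw [← hG.isLeast_one.unique he] at hk
  exact ⟨y, k, k.2, hk⟩

theorem exists_eq_nsmul_one (hG : IsPresburgerGroup G) (n : ℕ) {g : G} (h0 : 0 ≤ g)
    (h : g ≤ n • hG.one) : ∃ r ≤ n, g = r • hG.one := by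
  induction n with
  | zero => exact ⟨0, le_rfl, by simpa using le_antisymm (by simpa using h) h0⟩
  | succ n ih =>
    rcases h.eq_or_lt with h | h
    · exact ⟨n + 1, le_rfl, h⟩
    · have h1 : hG.one ≤ (n + 1) • hG.one - g := hG.isLeast_one.2 (sub_pos.2 h)
      rw [succ_nsmul, le_sub_comm, add_sub_cancel_right] at h1
      obtain ⟨r, hr, rfl⟩ := ih h1
      exact ⟨r, by omega, rfl⟩

end IsPresburgerGroup

section BackAndForth

variable {ι : Type*} [Fintype ι]

/-- The back-and-forth property for a new element `a ≥ 0`, which occurs with the single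
coefficient `L`. Among the linear forms with coefficients bounded by `K`, let `t₀` take the greatest
value `≤ L a` at `x`; there is such a form because the zero form qualifies. If `L a = t₀(x) + r`
with `r ≤ L²`, then `L b = t₀(y) + r` has a solution `b` of the desired kind.
Otherwise there is even an `r` with `0 < r ≤ L²` such that `t₀(x) + r ≡ L a` modulo `L²`, and again
`L b = t₀(y) + r` will do. -/
theorem Similar.exists_of_nonneg (hG : IsPresburgerGroup G) {K L : ℕ} (hL : 0 < L) {x y : ι → G}
    (h : Similar hG.one (2 * K + L ^ 2) (L ^ 2) x y) {a : G} (ha : 0 ≤ a) :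
    ∃ b, (∃ z, a = b + L • z) ∧ ∀ (c : ι → ℤ) (d : ℤ), (∀ i, |c i| ≤ K) → |d| ≤ K →
      (linForm hG.one c d x ≤ L • a ↔ linForm hG.one c d y ≤ L • b) ∧
      (L • a ≤ linForm hG.one c d x ↔ L • b ≤ linForm hG.one c d y) := by
  classical
  set e := hG.one with he
  have e_pos : 0 < e := hG.isLeast_one.1
  let S : Finset ((ι → ℤ) × ℤ) :=
    ((Fintype.piFinset fun _ => Finset.Icc (-(K : ℤ)) K) ×ˢ Finset.Icc (-(K : ℤ)) K).filter
      fun t => linForm e t.1 t.2 x ≤ L • a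
  have memS (c : ι → ℤ) (d : ℤ) : (c, d) ∈ S ↔
      ((∀ i, |c i| ≤ K) ∧ |d| ≤ K) ∧ linForm e c d x ≤ L • a := by
    simp [S, abs_le]
  have S_nonempty : S.Nonempty :=
    ⟨(0, 0), (memS 0 0).2 ⟨by simp, by rw [linForm_zero]; exact nsmul_nonneg ha L⟩⟩
  obtain ⟨⟨c₀, d₀⟩, h₀, hmax⟩ := S.exists_max_image (fun t => linForm e t.1 t.2 x) S_nonempty
  obtain ⟨⟨hc₀, hd₀⟩, h₀⟩ := (memS _ _).1 h₀
  replace hmax (c : ι → ℤ) (d : ℤ) (hc : ∀ i, |c i| ≤ K) (hd : |d| ≤ K)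
      (hle : linForm e c d x ≤ L • a) : linForm e c d x ≤ linForm e c₀ d₀ x :=
    hmax (c, d) ((memS c d).2 ⟨⟨hc, hd⟩, hle⟩)
  -- It is enough to find `r` such that `t₀ + r` lies on the same side of each form as `L a` does.
  suffices key : ∃ r : ℕ, r ≤ L ^ 2 ∧ (∃ z, L • a = linForm e c₀ d₀ x + r • e + L ^ 2 • z) ∧
      ∀ (c : ι → ℤ) (d : ℤ), (∀ i, |c i| ≤ K) → |d| ≤ K →
        (linForm e c d x ≤ L • a ↔ linForm e c d x ≤ linForm e c₀ (d₀ + r) x) ∧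
        (L • a ≤ linForm e c d x ↔ linForm e c₀ (d₀ + r) x ≤ linForm e c d x) by
    obtain ⟨r, hr, ⟨z, hz⟩, hkey⟩ := key
    obtain ⟨w, hw⟩ := h.linForm_modEq c₀ d₀
    have hLb : L • (a - L • (z + w)) = linForm e c₀ (d₀ + r) y := by
      rw [linForm_add_const, smul_sub, hz, hw, smul_smul, ← sq, smul_add, natCast_zsmul]
      abel
    refine ⟨a - L • (z + w), ⟨z + w, by abel⟩, fun c d hc hd => ?_⟩
    have hr' : (r : ℤ) ≤ (L ^ 2 : ℕ) := by exact_mod_cast hr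
    have hcb (i) : |c i - c₀ i| ≤ (2 * K + L ^ 2 : ℕ) := by
      have := abs_le.1 (hc i)
      have := abs_le.1 (hc₀ i)
      rw [Nat.cast_add, Nat.cast_mul, abs_le]
      constructor <;> omega
    have hdb : |d - (d₀ + r)| ≤ (2 * K + L ^ 2 : ℕ) := by
      have := abs_le.1 hd
      have := abs_le.1 hd₀
      rw [Nat.cast_add, Nat.cast_mul, abs_le]
      constructor <;> omega
    rw [hLb, (hkey c d hc hd).1, (hkey c d hc hd).2]
    exact ⟨h.le_iff (fun i => abs_sub_comm (c i) _ ▸ hcb i) (abs_sub_comm d _ ▸ hdb),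
      h.le_iff hcb hdb⟩
  rcases le_or_gt (L • a - linForm e c₀ d₀ x) (L ^ 2 • e) with hsmall | hlarge
  · obtain ⟨r, hr, hr'⟩ := hG.exists_eq_nsmul_one (L ^ 2) (sub_nonneg.2 h₀) hsmall
    have hLa : L • a = linForm e c₀ d₀ x + r • e := by rw [← hr']; abel
    refine ⟨r, hr, ⟨0, by rw [hLa, smul_zero, add_zero]⟩, fun c d _ _ => ?_⟩
    rw [linForm_add_const, natCast_zsmul, hLa]
    exact ⟨Iff.rfl, Iff.rfl⟩
  · obtain ⟨z, k, hk, hz⟩ :=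
      hG.exists_divMod (pow_pos hL 2) (L • a - linForm e c₀ d₀ x - e)
    have hlt : linForm e c₀ (d₀ + (k + 1 : ℕ)) x < L • a := by
      rw [linForm_add_const, natCast_zsmul, ← lt_sub_iff_add_lt']
      exact (nsmul_le_nsmul_left e_pos.le (by omega)).trans_lt hlarge
    have hgt : linForm e c₀ d₀ x < linForm e c₀ (d₀ + (k + 1 : ℕ)) x := by
      rw [linForm_add_const, natCast_zsmul]
      exact lt_add_of_pos_right _ (nsmul_pos e_pos (by omega))
    refine ⟨k + 1, by omega, ⟨z, ?_⟩, fun c d hc hd => ⟨⟨fun hle => ?_, fun hle => ?_⟩,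
      ⟨fun hle => ?_, fun hle => ?_⟩⟩⟩
    · rw [← he] at hz
      have : L • a = linForm e c₀ d₀ x + e + (L • a - linForm e c₀ d₀ x - e) := by abel
      rw [this, hz, succ_nsmul]
      abel
    · exact (hmax c d hc hd hle).trans hgt.le
    · exact hle.trans hlt.le
    · exact hlt.le.trans hle
    · by_contra hnot
      exact absurd (hle.trans (hmax c d hc hd (not_le.1 hnot).le)) (not_le.2 hgt)

/-- The back-and-forth property. The coefficients `k` of the new element are reduced to the single
coefficient `L = N! m` by multiplying the linear forms with `L / |k|`. Negating all elements reduces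
the case `a < 0` to the case `a ≥ 0`. -/
theorem Similar.exists_extend (hG : IsPresburgerGroup G) {N m : ℕ} (hm : 0 < m) {x y : ι → G}
    (h : Similar hG.one (2 * (N.factorial * m * N) + (N.factorial * m) ^ 2)
      ((N.factorial * m) ^ 2) x y) (a : G) :
    ∃ b, (∃ z, a = b + m • z) ∧ ∀ (c : ι → ℤ) (d k : ℤ), (∀ i, |c i| ≤ N) → |d| ≤ N → |k| ≤ N →
      (0 ≤ linForm hG.one c d x + k • a ↔ 0 ≤ linForm hG.one c d y + k • b) := by
  wlog ha : 0 ≤ a generalizing a x y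
  · obtain ⟨b, ⟨z, hz⟩, hb⟩ := this h.neg (-a) (by simpa using (not_le.1 ha).le)
    refine ⟨-b, ⟨-z, by rw [← neg_neg a, hz, smul_neg, neg_add]⟩, fun c d k hc hd hk => ?_⟩
    simpa [linForm_neg_arg] using hb (-c) d (-k) (by simpa using hc) hd (by simpa using hk)
  set L := N.factorial * m with hLdef
  have hL : 0 < L := Nat.mul_pos N.factorial_pos hm
  obtain ⟨b, ⟨z, hz⟩, hb⟩ := h.exists_of_nonneg hG hL ha
  refine ⟨b, ⟨N.factorial • z, by rw [smul_smul, mul_comm, ← hLdef, hz]⟩,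
    fun c d k hc hd hk => ?_⟩
  have hscale {c : ι → ℤ} {d : ℤ} {q : ℕ} (hq : q ≤ L) (hc : ∀ i, |c i| ≤ N) (hd : |d| ≤ N) :
      (∀ i, |((q : ℤ) • c) i| ≤ (L * N : ℕ)) ∧ |(q : ℤ) • d| ≤ (L * N : ℕ) := by
    have hq : (q : ℤ) ≤ L := by exact_mod_cast hq
    have aux (j : ℤ) (hj : |j| ≤ N) : |(q : ℤ) * j| ≤ (L * N : ℕ) := by
      rw [abs_mul, Nat.abs_cast, Nat.cast_mul]
      exact mul_le_mul hq hj (abs_nonneg _) (by positivity)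
    exact ⟨fun i => aux _ (hc i), aux _ hd⟩
  have hdvd {j : ℕ} (hj : 0 < j) (hjN : j ≤ N) : ∃ q : ℕ, 0 < q ∧ q ≤ L ∧ L = q * j := by
    obtain ⟨q, hq⟩ := (Nat.dvd_factorial hj hjN).mul_right m
    rw [← hLdef] at hq
    have hq0 : 0 < q := Nat.pos_of_ne_zero (by rintro rfl; omega)
    exact ⟨q, hq0, by rw [hq]; exact Nat.le_mul_of_pos_left q hj, by rw [hq, mul_comm]⟩
  rcases lt_trichotomy k 0 with hk0 | rfl | hk0
  · obtain ⟨j, rfl⟩ := Int.exists_eq_neg_ofNat hk0.le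
    obtain ⟨q, hq0, hqL, hq⟩ := hdvd (j := j) (by omega) (by simpa using hk)
    obtain ⟨hc', hd'⟩ := hscale hqL hc hd
    have aux (s g : G) : 0 ≤ s + (-(j : ℤ)) • g ↔ L • g ≤ (q : ℤ) • s := by
      rw [hq, mul_smul, natCast_zsmul, nsmul_le_nsmul_iff_right hq0.ne', neg_smul, natCast_zsmul,
        ← sub_eq_add_neg, sub_nonneg]
    rw [aux, aux, ← linForm_smul, ← linForm_smul]
    exact (hb _ _ hc' hd').2
  · simp only [zero_smul, add_zero]
    have hN : N ≤ 2 * (L * N) + L ^ 2 := by nlinarith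
    exact (h.mono hN dvd_rfl).nonneg_iff c d hc hd
  · obtain ⟨j, rfl⟩ := Int.eq_ofNat_of_zero_le hk0.le
    obtain ⟨q, hq0, hqL, hq⟩ := hdvd (j := j) (by omega) (by simpa using hk)
    obtain ⟨hc', hd'⟩ := hscale (c := -c) (d := -d) hqL (by simpa using hc) (by simpa using hd)
    have aux (x : ι → G) (g : G) : 0 ≤ linForm hG.one c d x + (j : ℤ) • g ↔
        linForm hG.one ((q : ℤ) • -c) ((q : ℤ) • -d) x ≤ L • g := by
      have hneg : linForm hG.one (-c) (-d) x = -linForm hG.one c d x := by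
        simpa using linForm_smul hG.one (-1) c d x
      rw [linForm_smul, hneg, hq, mul_smul, natCast_zsmul, natCast_zsmul,
        nsmul_le_nsmul_iff_right hq0.ne', neg_le_iff_add_nonneg']
    rw [aux, aux]
    exact (hb _ _ hc' hd').1

end BackAndForth

/-! ### Formulas are determined by similarity -/

section Determined

variable {ι : Type*} [Fintype ι]

namespace IsDetermined

variable {e : G}

theorem linForm_le (c c' : ι → ℤ) (d d' : ℤ) :
    IsDetermined e fun x => linForm e c d x ≤ linForm e c' d' x := by
  refine ⟨∑ i, (c' i - c i).natAbs + (d' - d).natAbs, 1, one_pos, fun x y h => ?_⟩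
  refine (h.le_iff (fun i => ?_) ?_).1
  · rw [Int.abs_eq_natAbs, Nat.cast_le]
    exact (Finset.single_le_sum (f := fun i => (c' i - c i).natAbs) (fun _ _ => Nat.zero_le _)
      (Finset.mem_univ i)).trans (Nat.le_add_right _ _)
  · rw [Int.abs_eq_natAbs, Nat.cast_le]
    exact Nat.le_add_left _ _

theorem linForm_eq (c c' : ι → ℤ) (d d' : ℤ) :
    IsDetermined e fun x => linForm e c d x = linForm e c' d' x := by
  simpa only [le_antisymm_iff] using (linForm_le c c' d d').and (linForm_le c' c d' d)

end IsDetermined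

/-- Invariance under similarity passes from a property of tuples to its universal quantification
over the last entry. -/
theorem IsDetermined.forall_snoc (hG : IsPresburgerGroup G) {α : Type*} [Fintype α] {n : ℕ}
    {P : (α → G) → (Fin (n + 1) → G) → Prop}
    (hP : IsDetermined hG.one fun x : α ⊕ Fin (n + 1) → G => P (x ∘ Sum.inl) (x ∘ Sum.inr)) :
    IsDetermined hG.one fun x : α ⊕ Fin n → G =>
      ∀ a, P (x ∘ Sum.inl) (Fin.snoc (x ∘ Sum.inr) a) := by
  obtain ⟨N, m, hm, h⟩ := hP
  refine ⟨2 * (N.factorial * m * N) + (N.factorial * m) ^ 2, (N.factorial * m) ^ 2,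
    pow_pos (Nat.mul_pos N.factorial_pos hm) 2, fun x y hxy hx b => ?_⟩
  obtain ⟨a, ⟨z, hz⟩, hab⟩ := hxy.symm.exists_extend hG hm b
  refine h (Sum.elim (x ∘ Sum.inl) (Fin.snoc (x ∘ Sum.inr) a))
    (Sum.elim (y ∘ Sum.inl) (Fin.snoc (y ∘ Sum.inr) b)) (Similar.symm ⟨fun c d hc hd => ?_, ?_⟩)
    (hx a)
  · rw [linForm_sumElim_snoc, linForm_sumElim_snoc, Sum.elim_comp_inl_inr, Sum.elim_comp_inl_inr]
    exact hab _ d _ (by rintro (i | i) <;> exact hc _) hd (hc _)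
  · have hyx := hxy.symm.mono le_rfl
      (((dvd_mul_left m N.factorial).trans (dvd_pow_self _ two_ne_zero)))
    rintro (i | i)
    · exact hyx.modEq _
    · refine Fin.lastCases ?_ (fun i => ?_) i
      · simpa using ⟨z, hz⟩
      · simpa using hyx.modEq (Sum.inr i)

/-- If the terms of a language are interpreted by linear forms and its relation symbols by
determined properties, then all formulas define determined properties. -/
theorem isDetermined_realize (hG : IsPresburgerGroup G) {L : Language} [L.Structure G]
    {α : Type*} [Fintype α]
    (hterm : ∀ {n : ℕ} (t : L.Term (α ⊕ Fin n)), ∃ (c : α ⊕ Fin n → ℤ) (d : ℤ),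
      ∀ x : α ⊕ Fin n → G, t.realize x = linForm hG.one c d x)
    (hrel : ∀ {n l : ℕ} (R : L.Relations l) (ts : Fin l → L.Term (α ⊕ Fin n)),
      IsDetermined hG.one fun x : α ⊕ Fin n → G =>
        Structure.RelMap R fun i => (ts i).realize x)
    {n : ℕ} (φ : L.BoundedFormula α n) :
    IsDetermined hG.one fun x : α ⊕ Fin n → G => φ.Realize (x ∘ Sum.inl) (x ∘ Sum.inr) := by
  induction φ with
  | falsum => exact ⟨0, 1, one_pos, fun _ _ _ h => h⟩
  | equal t₁ t₂ =>
    obtain ⟨c, d, h₁⟩ := hterm t₁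
    obtain ⟨c', d', h₂⟩ := hterm t₂
    simpa only [BoundedFormula.Realize, Sum.elim_comp_inl_inr, h₁, h₂] using
      IsDetermined.linForm_eq c c' d d'
  | rel R ts => simpa only [BoundedFormula.Realize, Sum.elim_comp_inl_inr] using hrel R ts
  | imp φ ψ hφ hψ => exact hφ.imp hψ
  | all φ hφ => exact hφ.forall_snoc hG

end Determined

/-! ### The kernel of the residue map -/

namespace IsPresburgerGroup

theorem exists_eq_nsmul_of_residueMod_eq_zero (hG : IsPresburgerGroup G) {n : ℕ+} {a : G}
    (h : hG.residueMod n a = 0) : ∃ y, a = (n : ℕ) • y := by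
  obtain ⟨y, k, hk, rfl⟩ := hG.exists_divMod n.pos a
  simp only [map_add, map_nsmul, residueMod_one, nsmul_eq_mul, CharP.cast_eq_zero, zero_mul,
    zero_add, mul_one] at h
  rw [ZMod.natCast_eq_zero_iff] at h
  exact ⟨y, by rw [Nat.eq_zero_of_dvd_of_lt h hk, zero_smul, add_zero]⟩

theorem nsmul_one_lt_of_residueMod_eq_zero (hG : IsPresburgerGroup G) {a : G} (ha : 0 < a)
    (h : ∀ n, hG.residueMod n a = 0) (d : ℕ) : d • hG.one < a := by
  by_contra hd
  obtain ⟨r, -, rfl⟩ := hG.exists_eq_nsmul_one d ha.le (not_lt.1 hd)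
  -- The residue of `r 1` modulo `r + 1` is zero only if `r = 0`.
  have hr := h r.succPNat
  rw [map_nsmul, residueMod_one, nsmul_one, ZMod.natCast_eq_zero_iff, Nat.succPNat_coe] at hr
  have : r = 0 := Nat.eq_zero_of_dvd_of_lt hr r.lt_succ_self
  simp [this] at ha

theorem nonneg_zsmul_add_iff (hG : IsPresburgerGroup G) {a : G} (h : ∀ d : ℕ, d • hG.one < a)
    (c d : ℤ) : 0 ≤ c • a + d • hG.one ↔ 0 < c ∨ c = 0 ∧ 0 ≤ d := by
  have e_pos : 0 < hG.one := hG.isLeast_one.1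
  have ha : 0 < a := by simpa using h 0
  have hbound : |d| • hG.one < a := by
    rw [Int.abs_eq_natAbs, natCast_zsmul]
    exact h _
  rcases lt_trichotomy c 0 with hc | rfl | hc
  · refine iff_of_false (fun h0 => ?_) (by omega)
    have h1 : a ≤ (-c) • a := by
      simpa using zsmul_le_zsmul_left ha.le (show (1 : ℤ) ≤ -c by omega)
    have h2 : d • hG.one ≤ |d| • hG.one := zsmul_le_zsmul_left e_pos.le (le_abs_self d)
    rw [neg_smul] at h1
    have h3 : c • a + d • hG.one < -a + a :=
      add_lt_add_of_le_of_lt (le_neg.1 h1) (h2.trans_lt hbound)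
    exact absurd (h0.trans_lt h3) (by simp)
  · simpa using zsmul_le_zsmul_iff_left e_pos (m := 0) (n := d)
  · refine iff_of_true ?_ (Or.inl hc)
    have h1 : a ≤ c • a := by
      simpa using zsmul_le_zsmul_left ha.le (show (1 : ℤ) ≤ c by omega)
    have h2 : (-d) • hG.one ≤ |d| • hG.one := zsmul_le_zsmul_left e_pos.le (neg_le_abs d)
    rw [neg_smul] at h2
    exact neg_le_iff_add_nonneg.1 ((h2.trans hbound.le).trans h1)

/-- A positive element `a` of the kernel of the residue map and its double are similar in all
degrees: the value `c a + d 1` has the sign of `c`, or that of `d` if `c = 0`. -/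
theorem similar_two_nsmul (hG : IsPresburgerGroup G) {a : G} (ha : 0 < a)
    (h : ∀ n, hG.residueMod n a = 0) (N : ℕ) {m : ℕ} (hm : 0 < m) {ι : Type*} [Fintype ι] :
    Similar hG.one N m (fun _ : ι => 2 • a) fun _ => a where
  nonneg_iff c d _ _ := by
    simp only [linForm, ← Finset.sum_smul]
    rw [hG.nonneg_zsmul_add_iff (hG.nsmul_one_lt_of_residueMod_eq_zero ha h),
      hG.nonneg_zsmul_add_iff (hG.nsmul_one_lt_of_residueMod_eq_zero (nsmul_pos ha two_ne_zero)
        fun n => by rw [map_nsmul, h, smul_zero])]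
  modEq _ := by
    obtain ⟨z, hz⟩ := hG.exists_eq_nsmul_of_residueMod_eq_zero (h ⟨m, hm⟩)
    exact ⟨z, by rw [two_nsmul]; exact congrArg (a + ·) hz⟩

theorem residue_eq_zero_iff (hG : IsPresburgerGroup G) {a : G} :
    hG.residue a = 0 ↔ ∀ n, hG.residueMod n a = 0 := by
  rw [Subtype.ext_iff, funext_iff]
  rfl

/-- If formulas in one free variable are determined, then the Leibniz property forces the residue
map to be injective. -/
theorem residue_injective_of_leibnizian (hG : IsPresburgerGroup G) {L : Language} [L.Structure G]
    (hL : ∀ φ : L.Formula (Fin 1), IsDetermined hG.one fun x : Fin 1 ⊕ Fin 0 → G =>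
      BoundedFormula.Realize φ (x ∘ Sum.inl) (x ∘ Sum.inr))
    (h : Leibnizian L G) : Function.Injective hG.residue := by
  have key (a : G) (ha : 0 < a) : hG.residue a ≠ 0 := by
    rw [Ne, residue_eq_zero_iff]
    intro hres
    obtain ⟨φ, h1, h2⟩ := h (2 • a) a (by simpa [two_nsmul] using ha.ne')
    obtain ⟨N, m, hm, hφ⟩ := hL φ
    refine h2 ?_
    have := hφ _ _ (hG.similar_two_nsmul ha hres N hm)
    rw [Formula.Realize, Subsingleton.elim default _] at h1 ⊢
    exact this h1
  rw [injective_iff_map_eq_zero]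
  intro a ha
  rcases lt_trichotomy a 0 with h0 | h0 | h0
  · exact absurd (by rw [map_neg, ha, neg_zero]) (key (-a) (neg_pos.2 h0))
  · exact h0
  · exact absurd ha (key a h0)

/-- Elements with distinct residues are separated by the condition `x ∈ n G + k 1` for some `n` and
`k`. -/
theorem exists_separation (hG : IsPresburgerGroup G) (h : Function.Injective hG.residue) {a b : G}
    (hab : a ≠ b) : ∃ n k : ℕ, (∃ y, a = n • y + k • hG.one) ∧ ¬ ∃ y, b = n • y + k • hG.one := by
  obtain ⟨n, hn⟩ : ∃ n, hG.residueMod n a ≠ hG.residueMod n b := by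
    by_contra! hall
    exact hab (h (Subtype.ext (funext hall)))
  obtain ⟨y, k, -, hk⟩ := hG.exists_divMod n.pos a
  refine ⟨n, k, ⟨y, hk⟩, fun ⟨z, hz⟩ => hn ?_⟩
  rw [hk, hz]
  simp

end IsPresburgerGroup

end Order

/-! ### Formulas that define the residue classes -/

section PtLang

/-- The term `s + t + ⋯ + t`, with `k` summands `t`, in the language `(+, 1)`. -/
def ptAddMulT {α : Type} (s t : ptLang.Term α) : ℕ → ptLang.Term α
  | 0 => s
  | k + 1 => Functions.apply₂ (L := ptLang) PtFunc.add (ptAddMulT s t k) t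

theorem realize_ptAddMulT (e : G) {α : Type} (s t : ptLang.Term α) (v : α → G) (k : ℕ) :
    letI := ptStructure e
    (ptAddMulT s t k).realize v = s.realize v + k • t.realize v := by
  let := ptStructure e
  induction k with
  | zero => simp [ptAddMulT]
  | succ k ih =>
    rw [succ_nsmul, ← add_assoc, ← ih]
    rfl

theorem exists_formula_ptLang (e : G) (n k : ℕ) : letI := ptStructure e
    ∃ φ : ptLang.Formula (Fin 1), ∀ a : G, φ.Realize (fun _ => a) ↔ ∃ y, a = n • y + k • e := by
  let := ptStructure e
  -- The language has no symbol for `0`, which is defined by `z + z = z`.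
  let φ : ptLang.Formula (Fin 1) := BoundedFormula.ex <| BoundedFormula.ex <|
    (ptAddMulT (&0) (&0) 1).bdEqual (&0 : ptLang.Term (Fin 1 ⊕ Fin 2)) ⊓
    (Term.var (Sum.inl 0) : ptLang.Term (Fin 1 ⊕ Fin 2)).bdEqual
      (ptAddMulT (ptAddMulT (&0) (&1) n) (Constants.term (L := ptLang) PtFunc.one) k)
  have realize_one (v : Fin 1 ⊕ Fin 2 → G) :
      (Constants.term (L := ptLang) (α := Fin 1 ⊕ Fin 2) PtFunc.one).realize v = e := rfl
  refine ⟨φ, fun a => ?_⟩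
  simp [φ, Formula.Realize, realize_ptAddMulT, realize_one, Fin.snoc]

end PtLang

section OrdLang

variable [LinearOrder G] [IsOrderedAddMonoid G]

theorem exists_formula_ordLang (hG : IsPresburgerGroup G) (n k : ℕ) :
    ∃ φ : ordLang.Formula (Fin 1), ∀ a : G,
      φ.Realize (fun _ => a) ↔ ∃ y, a = n • y + k • hG.one := by
  let le {j : ℕ} (s t : ordLang.Term (Fin 1 ⊕ Fin j)) : ordLang.BoundedFormula (Fin 1) j :=
    Relations.boundedFormula₂ (L := ordLang) OrdRel.le s t
  have realize_le {j : ℕ} (s t : ordLang.Term (Fin 1 ⊕ Fin j)) (v : Fin 1 → G) (xs : Fin j → G) :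
      (le s t).Realize v xs ↔ s.realize (Sum.elim v xs) ≤ t.realize (Sum.elim v xs) := Iff.rfl
  -- The bound variables are `0`, its successor `1`, and then the `y` with `x = n y + k 1`.
  let φ : ordLang.Formula (Fin 1) := BoundedFormula.ex <| BoundedFormula.ex <|
    ((addT (&0) (&0)).bdEqual (&0 : ordLang.Term (Fin 1 ⊕ Fin 2)) ⊓ ∼(le (&1) (&0)) ⊓
      BoundedFormula.all (∼(le (&2) (&0)) ⟹ le (&1) (&2))) ⊓
    BoundedFormula.ex ((Term.var (Sum.inl 0) : ordLang.Term (Fin 1 ⊕ Fin 3)).bdEqual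
      (addMulT (addMulT (&0) (&2) n) (&1) k))
  have hφ (a : G) : φ.Realize (fun _ => a) ↔
      ∃ e : G, IsLeast {x : G | 0 < x} e ∧ ∃ y, a = n • y + k • e := by
    simp [φ, Formula.Realize, realize_addT, realize_addMulT, realize_le, Fin.snoc, IsLeast,
      mem_lowerBounds]
  refine ⟨φ, fun a => (hφ a).trans ⟨fun ⟨e, he, h⟩ => ?_, fun h => ⟨_, hG.isLeast_one, h⟩⟩⟩
  rwa [hG.isLeast_one.unique he]

end OrdLang

end ZGroups

theorem mainTheorem3 {G : Type*} [AddCommGroup G] [LinearOrder G] [IsOrderedAddMonoid G]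
    (hG : ZGroups.IsPresburgerGroup G) :
    List.TFAE [
      ZGroups.Leibnizian ZGroups.ordLang G,
      @ZGroups.Leibnizian ZGroups.ptLang G (ZGroups.ptStructure hG.one),
      Function.Injective hG.residue] := by
  tfae_have 1 → 3 := by
    refine hG.residue_injective_of_leibnizian fun φ => ZGroups.isDetermined_realize hG
      (fun t => ZGroups.exists_linForm_realize_ordLang hG.one t) (fun R ts => ?_) φ
    cases R
    obtain ⟨c, d, h⟩ := ZGroups.exists_linForm_realize_ordLang hG.one (ts 0)
    obtain ⟨c', d', h'⟩ := ZGroups.exists_linForm_realize_ordLang hG.one (ts 1)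
    have hle := ZGroups.IsDetermined.linForm_le (e := hG.one) c c' d d'
    simp only [← h, ← h'] at hle
    exact hle
  tfae_have 2 → 3 := by
    let := ZGroups.ptStructure hG.one
    exact hG.residue_injective_of_leibnizian fun φ => ZGroups.isDetermined_realize hG
      (fun t => ZGroups.exists_linForm_realize_ptLang hG.one t) (fun R _ => R.elim) φ
  tfae_have 3 → 1 := by
    intro h a b hab
    obtain ⟨n, k, ha, hb⟩ := hG.exists_separation h hab
    obtain ⟨φ, hφ⟩ := ZGroups.exists_formula_ordLang hG n k
    exact ⟨φ, (hφ a).2 ha, fun hr => hb ((hφ b).1 hr)⟩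
  tfae_have 3 → 2 := by
    intro h a b hab
    obtain ⟨n, k, ha, hb⟩ := hG.exists_separation h hab
    obtain ⟨φ, hφ⟩ := ZGroups.exists_formula_ptLang hG.one n k
    exact ⟨φ, (hφ a).2 ha, fun hr => hb ((hφ b).1 hr)⟩
  tfae_finish
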